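/- There is an absolute constant $C>0$ such that the following holds for every full-rank lattice $\Lambda\subset\mathbb{R}^3$ (a discrete subgroup spanning $\mathbb{R}^3$) and every real $R>0$. Let $|\cdot|$ be the Euclidean norm on $\mathbb{R}^3$, let $\operatorname{covol}(\Lambda)>0$ be the covolume of $\Lambda$ (the volume of a fundamental domain), and for $j=1,2,3$ let $\lambda_j$ be the $j$-th successive minimum of $\Lambda$, i.e. the least real number $r\ge 0$ such that $\Lambda$ contains $j$ linearly independent vectors of norm $\le r$. Call $v\in\Lambda\setminus\{0\}$ primitive if $v=nw$ with $n\in\mathbb{Z}$ and $w\in\Lambda$ implies $n=\pm1$, and put $\log^*(t):=\max(1,\log t)$ for $t>0$. Then the number $$N:=\#\{v\in\Lambda\setminus\{0\} : |v|<R,\ v \text{ primitive}\}$$ is finite and satisfies $$\left|N-\frac{4\pi}{3\zeta(3)}\cdot\frac{R^3}{\operatorname{covol}(\Lambda)}\right|\le C\left(\log^*(R/\lambda_1)\cdot\frac{\lambda_2\lambda_3R}{\operatorname{covol}(\Lambda)}+\frac{\lambda_3R^2}{\operatorname{covol}(\Lambda)}\right).$$ -/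

import Mathlib

noncomputable section

/-- The `j`-th successive minimum of a lattice `Λ`: the least real number `r ≥ 0` such that `Λ`
contains `j` linearly independent vectors of norm at most `r`. -/
def successiveMinimum {E : Type*} [NormedAddCommGroup E] [NormedSpace ℝ E]
    (Λ : Submodule ℤ E) (j : ℕ) : ℝ :=
  sInf {r : ℝ | 0 ≤ r ∧ ∃ v : Fin j → E,
    (∀ i, v i ∈ Λ ∧ ‖v i‖ ≤ r) ∧ LinearIndependent ℝ v}

/-- A vector of `Λ` is primitive if it is nonzero and is an integer multiple `n • w` of a vector
`w` of `Λ` only for `n = 1` and `n = -1`. -/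
def IsPrimitiveVector {E : Type*} [AddCommGroup E] (Λ : Submodule ℤ E) (v : E) : Prop :=
  v ∈ Λ ∧ v ≠ 0 ∧ ∀ (n : ℤ) (w : E), w ∈ Λ → v = n • w → n = 1 ∨ n = -1

/-- The set of primitive vectors of `Λ` of norm less than `R`. -/
def primitiveVectorsLT {E : Type*} [NormedAddCommGroup E] (Λ : Submodule ℤ E) (R : ℝ) : Set E :=
  {v : E | IsPrimitiveVector Λ v ∧ ‖v‖ < R}

/-- `log^* t = max (1, log t)`. -/
def logStar (t : ℝ) : ℝ := max 1 (Real.log t)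

end

open MeasureTheory Module

/-! Sort the nonzero lattice vectors by content and apply Möbius inversion: with A(r) the number of
lattice points in the open ball of radius r and K = ⌊R/λ₁⌋, N = ∑_{d ≤ K} μ(d) (A(R/d) − 1)
(`ncard_primitiveVectorsLT_eq_sum`). Larger d do not occur, since a vector divisible by d has norm
at least dλ₁.

Every radius r = R/d that occurs satisfies r ≥ λ₁, and there A(r) − 1 equals the ball volume over
the covolume up to O((λ₂λ₃r + λ₃r²)/covol) (`abs_ncard_latticeBall_sub_one_sub_le`). For r > λ₃ this
is a covering argument. For r ≤ λ₃ the volume is itself part of the error, the points lie on a line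
or in a plane, and a separation count combined with covol ≤ λ₁λ₂λ₃ bounds A(r).

Summed over d, the error terms produce ∑ 1/d, hence the logarithm, and the bounded ∑ 1/d².
Completing ∑ μ(d)/d³ to 1/ζ(3) costs O(λ₁/R) times R³/covol, which is at most a multiple of
λ₃R²/covol. -/

/-- The set of vectors of `Λ` of norm less than `r`. -/
def latticeBall {E : Type*} [NormedAddCommGroup E] (Λ : Submodule ℤ E) (r : ℝ) : Set E :=
  {v : E | v ∈ Λ ∧ ‖v‖ < r}

theorem tsum_indicator_ball_eq_ncard {E : Type*} [NormedAddCommGroup E]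
    (Λ : Submodule ℤ E) (r : ℝ) (hfin : (latticeBall Λ r).Finite) :
    ∑' q : Λ, (Metric.ball (0 : E) r).indicator (1 : E → ENNReal) q =
      ((latticeBall Λ r).ncard : ENNReal) := by
  have h1 : ∀ q : Λ, (Metric.ball (0 : E) r).indicator (1 : E → ENNReal) q =
      (((↑) : Λ → E) ⁻¹' Metric.ball (0 : E) r).indicator (1 : Λ → ENNReal) q := fun q => rfl
  simp_rw [h1]
  rw [← tsum_subtype, Pi.one_def, ENNReal.tsum_set_one]
  have h2 : latticeBall Λ r = ((↑) : Λ → E) '' (((↑) : Λ → E) ⁻¹' Metric.ball (0 : E) r) := by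
    ext v
    simp [latticeBall, and_comm]
  rw [h2] at hfin ⊢
  rw [Set.ncard_image_of_injective _ Subtype.val_injective]
  have h3 := hfin.of_finite_image Subtype.val_injective.injOn
  rw [← h3.cast_ncard_eq]
  rfl

theorem indicator_ball_le_indicator_ball {E : Type*} [NormedAddCommGroup E] {a b : E} {r s : ℝ}
    (h : ‖a‖ < r → ‖b‖ < s) :
    (Metric.ball (0 : E) r).indicator (1 : E → ENNReal) a ≤
      (Metric.ball (0 : E) s).indicator (1 : E → ENNReal) b := by
  by_cases ha : ‖a‖ < r
  · rw [Set.indicator_of_mem (by simpa using ha), Set.indicator_of_mem (by simpa using h ha)]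
    rfl
  · rw [Set.indicator_of_notMem (by simpa using ha)]
    exact zero_le

/-! ### Lattice points in a ball against its volume -/

section Counting

variable {E : Type*} [NormedAddCommGroup E] [NormedSpace ℝ E] [FiniteDimensional ℝ E]
  (Λ : Submodule ℤ E) [DiscreteTopology Λ]

theorem finite_lattice_inter_closedBall (r : ℝ) : {v : E | v ∈ Λ ∧ ‖v‖ ≤ r}.Finite := by
  have : ProperSpace E := FiniteDimensional.proper ℝ E
  have h := Metric.finite_isBounded_inter_isClosed (K := Metric.closedBall (0 : E) r)
    (s := (Λ : Set E)) (isDiscrete_iff_discreteTopology.mpr ‹_›)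
    Metric.isBounded_closedBall
    (AddSubgroup.isClosed_of_discrete (H := Λ.toAddSubgroup))
  refine h.subset fun v hv => ⟨by simpa using hv.2, hv.1⟩

theorem finite_latticeBall (r : ℝ) : (latticeBall Λ r).Finite :=
  (finite_lattice_inter_closedBall Λ r).subset fun _ hv => ⟨hv.1, hv.2.le⟩

variable [MeasurableSpace E] [BorelSpace E] (μ : Measure E) [μ.IsAddHaarMeasure] [IsZLattice ℝ Λ]

theorem exists_addFundamentalDomain : ∃ F : Set E, IsAddFundamentalDomain Λ F μ ∧
    (∀ f : E → ENNReal, ∫⁻ x, f x ∂μ = ∑' g : Λ, ∫⁻ x in F, f (g + x) ∂μ) ∧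
    (∀ t : Set E, μ t = ∑' g : Λ, μ ((fun x => g + x) '' t ∩ F)) ∧
    μ F = ENNReal.ofReal (ZLattice.covolume Λ μ) := by
  have h := ZLattice.isAddFundamentalDomain (Free.chooseBasis ℤ Λ) μ
  have h' : IsAddFundamentalDomain Λ.toAddSubgroup _ μ := h
  have : Countable Λ.toAddSubgroup := (inferInstance : Countable Λ)
  refine ⟨_, h, h'.lintegral_eq_tsum'', h'.measure_eq_tsum, ?_⟩
  rw [ZLattice.covolume_eq_measure_fundamentalDomain Λ μ h, measureReal_def, ENNReal.ofReal_toReal]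
  exact (ZSpan.fundamentalDomain_isBounded _).measure_lt_top.ne

/-- A measurable set whose translates cover the space has measure at least the covolume. -/
theorem covolume_le_measure_of_covers {t : Set E} (ht : ∀ x : E, ∃ p ∈ Λ, x - p ∈ t) :
    ENNReal.ofReal (ZLattice.covolume Λ μ) ≤ μ t := by
  obtain ⟨F, -, -, hF, hvol⟩ := exists_addFundamentalDomain Λ μ
  rw [hF t, ← hvol]
  refine (measure_mono fun x hx => ?_).trans (measure_iUnion_le _)
  obtain ⟨p, hp, hxp⟩ := ht x
  exact Set.mem_iUnion.mpr ⟨⟨p, hp⟩, ⟨x - p, hxp, by simp⟩, hx⟩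

variable {Λ}

/-- Unfolding over a fundamental domain: the integrand at x counts the lattice translates of x that
fall in the ball. -/
theorem measure_ball_eq_lintegral_tsum (s : ℝ) : ∃ F : Set E,
    μ (Metric.ball 0 s) =
      ∫⁻ x in F, ∑' g : Λ, (Metric.ball 0 s).indicator (1 : E → ENNReal) (g + x) ∂μ ∧
    μ F = ENNReal.ofReal (ZLattice.covolume Λ μ) := by
  obtain ⟨F, -, hF, -, hvol⟩ := exists_addFundamentalDomain Λ μ
  refine ⟨F, ?_, hvol⟩
  have h0 := hF ((Metric.ball 0 s).indicator 1)
  rwa [lintegral_indicator_one Metric.isOpen_ball.measurableSet, ← lintegral_tsum] at h0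
  intro g
  exact ((measurable_one.indicator Metric.isOpen_ball.measurableSet).comp
    (measurable_const_add _)).aemeasurable

theorem ncard_latticeBall_mul_covolume_le {D : ℝ} (hD : ∀ x : E, ∃ p ∈ Λ, ‖x - p‖ ≤ D) (r : ℝ) :
    ((latticeBall Λ r).ncard : ENNReal) * ENNReal.ofReal (ZLattice.covolume Λ μ) ≤
      μ (Metric.ball 0 (r + D)) := by
  obtain ⟨F, h0, hvol⟩ := measure_ball_eq_lintegral_tsum (Λ := Λ) μ (r + D)
  rw [h0, ← hvol, ← tsum_indicator_ball_eq_ncard Λ r (finite_latticeBall Λ r),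
    ← setLIntegral_const]
  refine lintegral_mono fun x => ?_
  obtain ⟨p, hp, hxp⟩ := hD x
  -- Reindexing by a lattice point p near x compares q with q + (x − p), which moves it by at most
  -- D.
  rw [← (Equiv.subRight (⟨p, hp⟩ : Λ)).tsum_eq
    (fun g : Λ => (Metric.ball (0 : E) (r + D)).indicator (1 : E → ENNReal) (g + x))]
  refine ENNReal.tsum_le_tsum fun q => indicator_ball_le_indicator_ball fun hq => ?_
  have h1 : ((Equiv.subRight (⟨p, hp⟩ : Λ) q : Λ) : E) + x = q + (x - p) := by
    simp only [Equiv.subRight_apply, Submodule.coe_sub]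
    abel
  rw [h1]
  exact (norm_add_le _ _).trans_lt (by linarith)

theorem measure_ball_le_ncard_latticeBall_mul_covolume {D : ℝ}
    (hD : ∀ x : E, ∃ p ∈ Λ, ‖x - p‖ ≤ D) (r : ℝ) :
    μ (Metric.ball 0 (r - D)) ≤
      ((latticeBall Λ r).ncard : ENNReal) * ENNReal.ofReal (ZLattice.covolume Λ μ) := by
  obtain ⟨F, h0, hvol⟩ := measure_ball_eq_lintegral_tsum (Λ := Λ) μ (r - D)
  rw [h0, ← hvol, ← tsum_indicator_ball_eq_ncard Λ r (finite_latticeBall Λ r),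
    ← setLIntegral_const]
  refine lintegral_mono fun x => ?_
  obtain ⟨p, hp, hxp⟩ := hD x
  rw [← (Equiv.subRight (⟨p, hp⟩ : Λ)).tsum_eq
    (fun g : Λ => (Metric.ball (0 : E) (r - D)).indicator (1 : E → ENNReal) (g + x))]
  refine ENNReal.tsum_le_tsum fun q => indicator_ball_le_indicator_ball fun hq => ?_
  have h1 : ((Equiv.subRight (⟨p, hp⟩ : Λ) q : Λ) : E) + x = q + (x - p) := by
    simp only [Equiv.subRight_apply, Submodule.coe_sub]
    abel
  rw [h1] at hq
  have h2 := norm_sub_le (q + (x - p)) (x - p)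
  rw [add_sub_cancel_right] at h2
  linarith

end Counting

/-! ### Successive minima and vectors attaining them -/

section SuccessiveMinima

variable {E : Type*} [NormedAddCommGroup E] [NormedSpace ℝ E] {Λ : Submodule ℤ E}

theorem successiveMinimum_le {j : ℕ} {r : ℝ} (hr : 0 ≤ r) (v : Fin j → E)
    (hv : ∀ i, v i ∈ Λ ∧ ‖v i‖ ≤ r) (hli : LinearIndependent ℝ v) :
    successiveMinimum Λ j ≤ r :=
  csInf_le ⟨0, fun _ h => h.1⟩ ⟨hr, v, hv, hli⟩

theorem successiveMinimum_nonneg (Λ : Submodule ℤ E) (j : ℕ) : 0 ≤ successiveMinimum Λ j :=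
  Real.sInf_nonneg fun _ h => h.1

theorem successiveMinimum_one_le {v : E} (hv : v ∈ Λ) (h0 : v ≠ 0) :
    successiveMinimum Λ 1 ≤ ‖v‖ :=
  successiveMinimum_le (norm_nonneg v) (fun _ => v) (fun _ => ⟨hv, le_rfl⟩)
    ((linearIndependent_unique_iff).mpr h0)

/-- Otherwise appending v to w would give k + 1 independent lattice vectors whose largest norm is
still below the minimum. -/
theorem mem_span_of_norm_lt_successiveMinimum {k : ℕ} {w : Fin k → E}
    (hli : LinearIndependent ℝ w) (hwΛ : ∀ i, w i ∈ Λ)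
    (hw : ∀ i, ‖w i‖ < successiveMinimum Λ (k + 1)) {v : E} (hvΛ : v ∈ Λ)
    (hv : ‖v‖ < successiveMinimum Λ (k + 1)) : v ∈ Submodule.span ℝ (Set.range w) := by
  by_contra h
  obtain ⟨m, hm⟩ := Finite.exists_max (fun i => ‖(Fin.snoc w v : Fin (k + 1) → E) i‖)
  have hlt : ∀ i, ‖(Fin.snoc w v : Fin (k + 1) → E) i‖ < successiveMinimum Λ (k + 1) := by
    intro m
    refine Fin.lastCases ?_ (fun m => ?_) m
    · simpa using hv
    · simpa using hw m
  refine (successiveMinimum_le (Λ := Λ) (norm_nonneg _) _ (fun i => ⟨?_, hm i⟩)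
    (hli.finSnoc h)).not_gt (hlt m)
  refine Fin.lastCases ?_ (fun m => ?_) i
  · simpa using hvΛ
  · simpa using hwΛ m

variable [FiniteDimensional ℝ E] [DiscreteTopology Λ] [IsZLattice ℝ Λ]

theorem exists_norm_le_successiveMinimum {j : ℕ} (hj : j ≤ finrank ℝ E) :
    ∃ v : Fin j → E, (∀ i, v i ∈ Λ ∧ ‖v i‖ ≤ successiveMinimum Λ j) ∧
      LinearIndependent ℝ v := by
  set l := successiveMinimum Λ j with hl
  have hne : {r : ℝ | 0 ≤ r ∧ ∃ v : Fin j → E,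
      (∀ i, v i ∈ Λ ∧ ‖v i‖ ≤ r) ∧ LinearIndependent ℝ v}.Nonempty := by
    have : Module.Finite ℤ Λ := ZLattice.module_finite ℝ Λ
    have : Module.Free ℤ Λ := ZLattice.module_free ℝ Λ
    let b := (finBasis ℤ Λ).ofZLatticeBasis ℝ Λ
    have hj' : j ≤ finrank ℤ Λ := by rwa [ZLattice.rank ℝ Λ]
    refine ⟨∑ i, ‖b i‖, Finset.sum_nonneg fun i _ => norm_nonneg _,
      fun i => b (Fin.castLE hj' i), fun i => ⟨?_, ?_⟩, ?_⟩
    · simp [b]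
    · exact Finset.single_le_sum (f := fun i => ‖b i‖) (fun i _ => norm_nonneg _)
        (Finset.mem_univ _)
    · exact b.linearIndependent.comp _ (Fin.castLE_injective hj')
  have hfin := finite_lattice_inter_closedBall Λ (l + 1)
  -- Only finitely many lattice vectors have norm at most l + 1, so for small e no norm lies in (l,
  -- l + e]; the infimum is therefore attained.
  have hev : ∀ᶠ e in nhdsWithin (0 : ℝ) (Set.Ioi 0),
      ∀ x ∈ {v : E | v ∈ Λ ∧ ‖v‖ ≤ l + 1}, l < ‖x‖ → l + e < ‖x‖ := by
    rw [hfin.eventually_all]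
    intro x _
    by_cases hx : l < ‖x‖
    · filter_upwards [mem_nhdsWithin_of_mem_nhds (Iio_mem_nhds (sub_pos.mpr hx))] with e he _
      have : e < ‖x‖ - l := he
      linarith
    · exact Filter.Eventually.of_forall fun _ h => absurd h hx
  have hev1 : ∀ᶠ e in nhdsWithin (0 : ℝ) (Set.Ioi 0), e < 1 :=
    mem_nhdsWithin_of_mem_nhds (Iio_mem_nhds one_pos)
  obtain ⟨e, he, he1, he0⟩ := (hev.and (hev1.and self_mem_nhdsWithin)).exists
  have he0' : 0 < e := he0
  obtain ⟨r, ⟨-, v, hv, hli⟩, hr⟩ := exists_lt_of_csInf_lt hne (lt_add_of_pos_right l he0')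
  refine ⟨v, fun i => ⟨(hv i).1, ?_⟩, hli⟩
  by_contra! h
  have := he (v i) ⟨(hv i).1, by linarith [(hv i).2]⟩ h
  linarith [(hv i).2]

theorem successiveMinimum_mono {j k : ℕ} (hjk : j ≤ k) (hk : k ≤ finrank ℝ E) :
    successiveMinimum Λ j ≤ successiveMinimum Λ k := by
  obtain ⟨v, hv, hli⟩ := exists_norm_le_successiveMinimum (Λ := Λ) hk
  exact successiveMinimum_le (successiveMinimum_nonneg Λ k) (fun i => v (Fin.castLE hjk i))
    (fun i => hv _) (hli.comp _ (Fin.castLE_injective hjk))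

theorem successiveMinimum_one_pos (h : 1 ≤ finrank ℝ E) : 0 < successiveMinimum Λ 1 := by
  obtain ⟨v, hv, hli⟩ := exists_norm_le_successiveMinimum (Λ := Λ) h
  exact (norm_pos_iff.mpr (hli.ne_zero 0)).trans_le (hv 0).2

/-- Successively minimal linearly independent vectors. -/
theorem exists_linearIndependent_norm_le_successiveMinimum {k : ℕ} (hk : k ≤ finrank ℝ E) :
    ∃ w : Fin k → E, (∀ i, w i ∈ Λ ∧ ‖w i‖ ≤ successiveMinimum Λ (i + 1)) ∧
      LinearIndependent ℝ w := by
  induction k with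
  | zero => exact ⟨Fin.elim0, fun i => i.elim0, linearIndependent_empty_type⟩
  | succ k ih =>
    obtain ⟨w, hw, hwli⟩ := ih (by omega)
    obtain ⟨v, hv, hvli⟩ := exists_norm_le_successiveMinimum (Λ := Λ) hk
    -- k + 1 independent vectors do not fit in the k-dimensional span of w.
    obtain ⟨i, hi⟩ : ∃ i, v i ∉ Submodule.span ℝ (Set.range w) := by
      by_contra! h
      have h1 := Submodule.finrank_mono (Submodule.span_le.mpr (Set.range_subset_iff.mpr h))
      rw [finrank_span_eq_card hwli, finrank_span_eq_card hvli] at h1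
      simp at h1
    refine ⟨Fin.snoc w (v i), ?_, hwli.finSnoc hi⟩
    intro m
    refine Fin.lastCases ?_ (fun m => ?_) m
    · simpa using hv i
    · simpa using hw m

end SuccessiveMinima

/-! ### Covering radius and covolume from independent lattice vectors -/

section Basis

variable {E : Type*} [NormedAddCommGroup E] [InnerProductSpace ℝ E]
  {Λ : Submodule ℤ E}

/-- Rounding coordinates down leaves a vector of the fundamental parallelepiped. The basis need not
generate Λ. -/
theorem exists_mem_norm_sub_le {ι : Type*} [Fintype ι] (b : Basis ι ℝ E) (hb : ∀ i, b i ∈ Λ)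
    (x : E) : ∃ p ∈ Λ, ‖x - p‖ ≤ ∑ i, ‖b i‖ :=
  ⟨ZSpan.floor b x, Submodule.span_le.mpr (Set.range_subset_iff.mpr hb) (ZSpan.floor b x).2,
    ZSpan.norm_fract_le b x⟩

/-- Hadamard's inequality for the covolume. -/
theorem covolume_le_prod_norm [FiniteDimensional ℝ E] [MeasurableSpace E] [BorelSpace E] [DiscreteTopology Λ]
    [IsZLattice ℝ Λ] {n : ℕ} (b : Basis (Fin n) ℝ E) (hb : ∀ i, b i ∈ Λ) :
    ZLattice.covolume Λ ≤ ∏ i, ‖b i‖ := by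
  have hn : Fact (finrank ℝ E = n) := ⟨by rw [finrank_eq_card_basis b, Fintype.card_fin]⟩
  let e : OrthonormalBasis (Fin n) ℝ E := (stdOrthonormalBasis ℝ E).reindex (finCongr hn.out)
  have h1 : ENNReal.ofReal (ZLattice.covolume Λ) ≤ volume (ZSpan.fundamentalDomain b) :=
    covolume_le_measure_of_covers Λ volume fun x => ⟨ZSpan.floor b x,
      Submodule.span_le.mpr (Set.range_subset_iff.mpr hb) (ZSpan.floor b x).2,
      ZSpan.fract_mem_fundamentalDomain b x⟩
  have h2 : ZLattice.covolume Λ ≤ volume.real (ZSpan.fundamentalDomain b) :=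
    (ENNReal.ofReal_le_iff_le_toReal (ZSpan.fundamentalDomain_isBounded b).measure_lt_top.ne).mp h1
  refine h2.trans ?_
  -- Relative to an orthonormal basis the volume is a determinant, to which Hadamard's bound
  -- applies.
  rw [ZSpan.measureReal_fundamentalDomain b volume e.toBasis,
    measureReal_congr (ZSpan.fundamentalDomain_ae_parallelepiped e.toBasis volume),
    measureReal_def, e.coe_toBasis, e.volume_parallelepiped, ENNReal.toReal_one, mul_one,
    ← e.toBasis.orientation.volumeForm_robust e rfl]
  exact Orientation.abs_volumeForm_apply_le _ _

end Basis

/-! ### Separated points on a line -/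

section Separated

/-- Pigeonhole: two points in the same cell of length δ would have values less than δ apart. -/
theorem card_le_of_separated {α : Type*} (s : Finset α) (f : α → ℝ) {B δ : ℝ} (hB0 : 0 ≤ B)
    (hδ : 0 < δ)
    (hB : ∀ a ∈ s, |f a| ≤ B) (hsep : ∀ a ∈ s, ∀ b ∈ s, a ≠ b → δ ≤ |f a - f b|) :
    (s.card : ℝ) ≤ 1 + 2 * B / δ := by
  rcases s.eq_empty_or_nonempty with rfl | ⟨a₀, -⟩
  · simp only [Finset.card_empty, Nat.cast_zero]
    positivity
  have hpos : ∀ a ∈ s, 0 ≤ (f a + B) / δ := fun a ha =>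
    div_nonneg (by linarith [(abs_le.mp (hB a ha)).1]) hδ.le
  have hcard : s.card ≤ (Finset.range (⌊2 * B / δ⌋₊ + 1)).card := by
    refine Finset.card_le_card_of_injOn (fun a => ⌊(f a + B) / δ⌋₊) (fun a ha => ?_) ?_
    · simp only [Finset.coe_range, Set.mem_Iio, Nat.lt_succ_iff]
      refine Nat.floor_le_floor ?_
      gcongr
      linarith [(abs_le.mp (hB a ha)).2]
    · intro a ha b hb hab
      by_contra hne
      have h1 := hsep a ha b hb hne
      have ha1 := Nat.floor_le (hpos a ha)
      have ha2 := Nat.lt_floor_add_one ((f a + B) / δ)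
      have hb1 := Nat.floor_le (hpos b hb)
      have hb2 := Nat.lt_floor_add_one ((f b + B) / δ)
      simp only at hab
      rw [hab] at ha1 ha2
      have h2 : |(f a + B) / δ - (f b + B) / δ| < 1 := abs_lt.mpr ⟨by linarith, by linarith⟩
      rw [← sub_div, add_sub_add_right_eq_sub, abs_div, abs_of_pos hδ, div_lt_one hδ] at h2
      linarith
  rw [Finset.card_range] at hcard
  have h1 : (s.card : ℝ) ≤ ⌊2 * B / δ⌋₊ + 1 := by exact_mod_cast hcard
  have h2 := Nat.floor_le (a := 2 * B / δ) (by positivity)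
  linarith

variable {E : Type*} [NormedAddCommGroup E] [NormedSpace ℝ E]

theorem card_le_of_separated_of_collinear (s : Finset E) (a : E) {r δ : ℝ} (hr : 0 ≤ r)
    (hδ : 0 < δ) (hs : ∀ p ∈ s, ‖p‖ ≤ r) (hsep : ∀ p ∈ s, ∀ q ∈ s, p ≠ q → δ ≤ ‖p - q‖)
    (hline : ∀ p ∈ s, ∀ q ∈ s, ∃ t : ℝ, p - q = t • a) :
    (s.card : ℝ) ≤ 1 + 4 * r / δ := by
  rcases s.eq_empty_or_nonempty with rfl | ⟨p₀, hp₀⟩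
  · simp only [Finset.card_empty, Nat.cast_zero]
    positivity
  choose! t ht using fun p hp => hline p hp p₀ hp₀
  -- Coordinates are taken relative to p₀, which need not be the origin; hence the range 2r.
  have key := card_le_of_separated s (fun p => t p * ‖a‖) (B := 2 * r) (by positivity) hδ (fun p hp => ?_)
    (fun p hp q hq hne => ?_)
  · calc (s.card : ℝ) ≤ _ := key
      _ = _ := by ring
  · have h := norm_sub_le p p₀
    rw [ht p hp, norm_smul, Real.norm_eq_abs] at h
    rw [abs_mul, abs_norm]
    linarith [hs p hp, hs p₀ hp₀]
  · have h := hsep p hp q hq hne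
    have h2 : p - q = (t p - t q) • a := by
      rw [sub_smul, ← ht p hp, ← ht q hq]
      abel
    rw [h2, norm_smul, Real.norm_eq_abs] at h
    rwa [← sub_mul, abs_mul, abs_norm]

end Separated

/-! ### Lattice points on a line or in a plane -/

section Plane

variable {E : Type*} [NormedAddCommGroup E] [InnerProductSpace ℝ E] {Λ : Submodule ℤ E}

/-- Lagrange–Gauss reduction: a lattice vector in the plane of the shortest vector `a` and a
vector `u` orthogonal to it has `u`-component at least half of the second minimum. -/
theorem half_successiveMinimum_two_le {a u : E} (ha : a ∈ Λ) (ha0 : a ≠ 0)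
    (hl : successiveMinimum Λ 1 ≤ successiveMinimum Λ 2)
    (ha1 : ‖a‖ ≤ successiveMinimum Λ 1) (hu : inner ℝ a u = 0) {x y : ℝ}
    (hz : x • a + y • u ∈ Λ) (hy : y • u ≠ 0) : successiveMinimum Λ 2 / 2 ≤ ‖y • u‖ := by
  set z := x • a + y • u with hzdef
  -- Subtracting the nearest integer multiple of a leaves an a-component of norm at most λ₁/2 ≤
  -- λ₂/2.
  set z' := (x - round x) • a + y • u with hz'
  have hau : ∀ s : ℝ, inner ℝ (s • a) (y • u) = (0 : ℝ) := fun s => by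
    simp [inner_smul_left, inner_smul_right, hu]
  have hnorm : ‖z'‖ * ‖z'‖ = ‖(x - round x) • a‖ * ‖(x - round x) • a‖ + ‖y • u‖ * ‖y • u‖ :=
    norm_add_sq_eq_norm_sq_add_norm_sq_of_inner_eq_zero _ _ (hau _)
  have hypos : 0 < ‖y • u‖ := norm_pos_iff.mpr hy
  have hz'0 : z' ≠ 0 := by
    intro h
    rw [h, norm_zero] at hnorm
    nlinarith [mul_self_nonneg ‖(x - round x) • a‖]
  have hz'Λ : z' ∈ Λ := by
    have : z' = z - round x • a := by
      rw [hz', hzdef, sub_smul, ← Int.cast_smul_eq_zsmul ℝ]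
      abel
    rw [this]
    exact Λ.sub_mem hz (Λ.smul_mem _ ha)
  have h1 : successiveMinimum Λ 1 ≤ ‖z'‖ := successiveMinimum_one_le hz'Λ hz'0
  have hli : LinearIndependent ℝ ![a, z'] := by
    rw [LinearIndependent.pair_iff]
    intro s t hst
    have ht : t = 0 := by
      have h := congrArg (fun v => inner ℝ v (y • u)) hst
      simp only [hz', smul_add, smul_smul, inner_add_left, inner_zero_left, hau, zero_add] at h
      rw [mul_smul, inner_smul_left, real_inner_self_eq_norm_mul_norm] at h
      rcases mul_eq_zero.mp h with h | h
      · simpa using h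
      · exact absurd (mul_self_eq_zero.mp h) hypos.ne'
    subst ht
    simpa [ha0] using hst
  have h2 : successiveMinimum Λ 2 ≤ ‖z'‖ := by
    refine successiveMinimum_le (norm_nonneg _) ![a, z'] (fun i => ?_) hli
    fin_cases i
    · exact ⟨ha, ha1.trans h1⟩
    · exact ⟨hz'Λ, le_rfl⟩
  have h3 : ‖(x - round x) • a‖ ≤ successiveMinimum Λ 2 / 2 := by
    rw [norm_smul, Real.norm_eq_abs]
    nlinarith [abs_sub_round x, norm_nonneg a, abs_nonneg (x - round x)]
  have hapos := norm_pos_iff.mpr ha0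
  -- Pythagoras would give λ₂² ≤ ‖z'‖² < λ₂²/4 + λ₂²/4.
  by_contra! h
  nlinarith [norm_nonneg ((x - round x) • a), successiveMinimum_nonneg Λ 2]


theorem ncard_latticeBall_le_of_line (hl : 0 < successiveMinimum Λ 1) {a : E} {r : ℝ} (hr : 0 ≤ r)
    (hfin : (latticeBall Λ r).Finite) (hspan : ∀ v ∈ latticeBall Λ r, ∃ t : ℝ, v = t • a) :
    ((latticeBall Λ r).ncard : ℝ) ≤ 1 + 4 * r / successiveMinimum Λ 1 := by
  rw [Set.ncard_eq_toFinset_card _ hfin]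
  have hmem : ∀ p ∈ hfin.toFinset, p ∈ latticeBall Λ r := fun p hp => hfin.mem_toFinset.mp hp
  refine card_le_of_separated_of_collinear _ a hr hl (fun p hp => (hmem p hp).2.le)
    (fun p hp q hq hne => successiveMinimum_one_le (Λ.sub_mem (hmem p hp).1 (hmem q hq).1)
      (sub_ne_zero.mpr hne)) (fun p hp q hq => ?_)
  obtain ⟨s, hs⟩ := hspan p (hmem p hp)
  obtain ⟨t, ht⟩ := hspan q (hmem q hq)
  exact ⟨s - t, by rw [sub_smul, ← hs, ← ht]⟩

/-- Slice by the coordinate along u, the part of b orthogonal to a. Each slice lies on a line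
parallel to a and is λ₁-separated, while distinct slices are at least λ₂/2 apart. -/
theorem ncard_latticeBall_le_of_plane (hl : 0 < successiveMinimum Λ 1)
    (hl12 : successiveMinimum Λ 1 ≤ successiveMinimum Λ 2) {a b : E} {r : ℝ} (hr : 0 ≤ r)
    (ha : a ∈ Λ) (ha1 : ‖a‖ ≤ successiveMinimum Λ 1) (hli : LinearIndependent ℝ ![a, b])
    (hfin : (latticeBall Λ r).Finite)
    (hspan : ∀ v ∈ latticeBall Λ r, ∃ s t : ℝ, v = s • a + t • b) :
    ((latticeBall Λ r).ncard : ℝ) ≤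
      (1 + 4 * r / successiveMinimum Λ 1) * (1 + 4 * r / successiveMinimum Λ 2) := by
  classical
  have ha0 : a ≠ 0 := hli.ne_zero 0
  set c : ℝ := inner ℝ a b / (‖a‖ * ‖a‖) with hc
  set u := b - c • a with hu
  have hapos := norm_pos_iff.mpr ha0
  have hau : inner ℝ a u = (0 : ℝ) := by
    rw [hu, inner_sub_right, inner_smul_right, real_inner_self_eq_norm_mul_norm, hc,
      div_mul_cancel₀ _ (mul_pos hapos hapos).ne', sub_self]
  have hu0 : u ≠ 0 := by
    intro h
    exact ((LinearIndependent.pair_iff' ha0).mp hli) c (sub_eq_zero.mp h).symm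
  have hupos := norm_pos_iff.mpr hu0
  have hspan' : ∀ v ∈ latticeBall Λ r, ∃ s t : ℝ, v = s • a + t • u := by
    intro v hv
    obtain ⟨s, t, rfl⟩ := hspan v hv
    refine ⟨s + t * c, t, ?_⟩
    rw [hu]
    module
  choose! x y hxy using hspan'
  have hmem : ∀ p ∈ hfin.toFinset, p ∈ latticeBall Λ r := fun p hp => hfin.mem_toFinset.mp hp
  have hsub : ∀ p ∈ hfin.toFinset, ∀ q ∈ hfin.toFinset,
      p - q = (x p - x q) • a + (y p - y q) • u := by
    intro p hp q hq
    nth_rewrite 1 [hxy p (hmem p hp), hxy q (hmem q hq)]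
    module
  have hfib : ∀ t ∈ hfin.toFinset.image y,
      ((hfin.toFinset.filter fun p => y p = t).card : ℝ) ≤ 1 + 4 * r / successiveMinimum Λ 1 := by
    intro t _
    refine card_le_of_separated_of_collinear _ a hr hl ?_ ?_ ?_
    · intro p hp
      exact (hmem p (Finset.mem_filter.mp hp).1).2.le
    · intro p hp q hq hne
      exact successiveMinimum_one_le (Λ.sub_mem (hmem p (Finset.mem_filter.mp hp).1).1
        (hmem q (Finset.mem_filter.mp hq).1).1) (sub_ne_zero.mpr hne)
    · intro p hp q hq
      rw [Finset.mem_filter] at hp hq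
      refine ⟨x p - x q, ?_⟩
      rw [hsub p hp.1 q hq.1, hp.2, hq.2, sub_self, zero_smul, add_zero]
  have himg : ((hfin.toFinset.image y).card : ℝ) ≤ 1 + 4 * r / successiveMinimum Λ 2 := by
    have h := card_le_of_separated (hfin.toFinset.image y) (fun t => t * ‖u‖) (B := r)
      (δ := successiveMinimum Λ 2 / 2) hr (half_pos (hl.trans_le hl12)) ?_ ?_
    · calc _ ≤ _ := h
        _ = _ := by ring
    · intro t ht
      obtain ⟨p, hp, rfl⟩ := Finset.mem_image.mp ht
      have h1 : ‖p‖ * ‖p‖ = ‖x p • a‖ * ‖x p • a‖ + ‖y p • u‖ * ‖y p • u‖ := by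
        nth_rewrite 1 2 [hxy p (hmem p hp)]
        refine norm_add_sq_eq_norm_sq_add_norm_sq_of_inner_eq_zero _ _
          (?_ : inner ℝ _ _ = (0 : ℝ))
        simp [inner_smul_left, inner_smul_right, hau]
      have h2 : ‖p‖ < r := (hmem p hp).2
      rw [abs_mul, abs_norm, ← Real.norm_eq_abs, ← norm_smul]
      refine (abs_le_of_sq_le_sq' ?_ hr).2
      nlinarith [mul_self_nonneg ‖x p • a‖, norm_nonneg p]
    · intro s hs t ht hne
      obtain ⟨p, hp, rfl⟩ := Finset.mem_image.mp hs
      obtain ⟨q, hq, rfl⟩ := Finset.mem_image.mp ht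
      rw [← sub_mul, abs_mul, abs_norm, ← Real.norm_eq_abs, ← norm_smul]
      refine half_successiveMinimum_two_le (x := x p - x q) ha ha0 hl12 ha1 hau ?_
        (smul_ne_zero (sub_ne_zero.mpr hne) hu0)
      rw [← hsub p hp q hq]
      exact Λ.sub_mem (hmem p hp).1 (hmem q hq).1
  rw [Set.ncard_eq_toFinset_card _ hfin,
    Finset.card_eq_sum_card_image y hfin.toFinset, Nat.cast_sum]
  calc _ ≤ ∑ _t ∈ hfin.toFinset.image y, (1 + 4 * r / successiveMinimum Λ 1) :=
        Finset.sum_le_sum hfib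
    _ = (1 + 4 * r / successiveMinimum Λ 1) * (hfin.toFinset.image y).card := by
        rw [Finset.sum_const, nsmul_eq_mul, mul_comm]
    _ ≤ _ := by gcongr

end Plane

/-! ### Counting all lattice points in a ball of ℝ³ -/

section Count

theorem ncard_latticeBall_successiveMinimum_one {E : Type*} [NormedAddCommGroup E]
    [NormedSpace ℝ E] {Λ : Submodule ℤ E} {r : ℝ} (hr : 0 < r) (hr1 : r ≤ successiveMinimum Λ 1) :
    (latticeBall Λ r).ncard = 1 := by
  have : latticeBall Λ r = {0} := by
    ext v
    constructor
    · rintro ⟨hv, hvr⟩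
      by_contra h0
      exact (hvr.trans_le hr1).not_ge (successiveMinimum_one_le hv h0)
    · rintro rfl
      exact ⟨Λ.zero_mem, by simpa using hr⟩
  rw [this, Set.ncard_singleton]

variable (Λ : Submodule ℤ (EuclideanSpace ℝ (Fin 3))) [DiscreteTopology Λ] [IsZLattice ℝ Λ]

theorem successiveMinimum_chain : 0 < successiveMinimum Λ 1 ∧
    successiveMinimum Λ 1 ≤ successiveMinimum Λ 2 ∧
    successiveMinimum Λ 2 ≤ successiveMinimum Λ 3 :=
  ⟨successiveMinimum_one_pos (by simp), successiveMinimum_mono (by simp) (by simp),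
    successiveMinimum_mono (by simp) (by simp)⟩

theorem exists_basis_norm_le : ∃ b : Basis (Fin 3) ℝ (EuclideanSpace ℝ (Fin 3)),
    (∀ i, b i ∈ Λ) ∧ ‖b 0‖ ≤ successiveMinimum Λ 1 ∧ ‖b 1‖ ≤ successiveMinimum Λ 2 ∧
      ‖b 2‖ ≤ successiveMinimum Λ 3 := by
  obtain ⟨w, hw, hli⟩ := exists_linearIndependent_norm_le_successiveMinimum (Λ := Λ) (k := 3)
    (by simp)
  refine ⟨basisOfLinearIndependentOfCardEqFinrank hli (by simp), fun i => ?_, ?_, ?_, ?_⟩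
  · simpa using (hw i).1
  · simpa using (hw 0).2
  · simpa using (hw 1).2
  · simpa using (hw 2).2

theorem covolume_le_prod_successiveMinimum : ZLattice.covolume Λ ≤
    successiveMinimum Λ 1 * successiveMinimum Λ 2 * successiveMinimum Λ 3 := by
  obtain ⟨b, hb, h1, h2, h3⟩ := exists_basis_norm_le Λ
  obtain ⟨p1, p12, p23⟩ := successiveMinimum_chain Λ
  refine (covolume_le_prod_norm b hb).trans ?_
  rw [Fin.prod_univ_three]
  have p2 := p1.trans_le p12
  gcongr

theorem volume_ball_zero_real {r : ℝ} (hr : 0 ≤ r) :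
    volume (Metric.ball (0 : EuclideanSpace ℝ (Fin 3)) r) =
      ENNReal.ofReal (4 / 3 * Real.pi * r ^ 3) := by
  rw [EuclideanSpace.volume_ball_fin_three, ← ENNReal.ofReal_pow hr,
    ← ENNReal.ofReal_mul (by positivity)]
  congr 1
  ring

theorem abs_ncard_latticeBall_sub_le_of_covering {D r : ℝ} (hD0 : 0 ≤ D) (hr : 0 ≤ r)
    (hD : ∀ x : EuclideanSpace ℝ (Fin 3), ∃ p ∈ Λ, ‖x - p‖ ≤ D) :
    |(latticeBall Λ r).ncard * ZLattice.covolume Λ - 4 / 3 * Real.pi * r ^ 3| ≤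
      4 / 3 * Real.pi * (3 * r ^ 2 * D + 3 * r * D ^ 2 + D ^ 3) := by
  have hc := ZLattice.covolume_pos Λ
  have hpi := Real.pi_pos
  have hup := ncard_latticeBall_mul_covolume_le volume hD r
  have hlo := measure_ball_le_ncard_latticeBall_mul_covolume volume hD r
  rw [← ENNReal.ofReal_natCast, ← ENNReal.ofReal_mul (by positivity)] at hup hlo
  rw [volume_ball_zero_real (by positivity), ENNReal.ofReal_le_ofReal_iff (by positivity)] at hup
  rw [abs_le]
  constructor
  · rcases le_total D r with h | h
    · rw [volume_ball_zero_real (by linarith), ENNReal.ofReal_le_ofReal_iff (by positivity)] at hlo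
      have : 0 ≤ Real.pi * (r * D ^ 2) := by positivity
      have : 0 ≤ Real.pi * D ^ 3 := by positivity
      linarith
    -- For D ≥ r the lower bound is trivial: the error term already exceeds the volume.
    · have h0 : 0 ≤ (latticeBall Λ r).ncard * ZLattice.covolume Λ := by positivity
      have h1 : r ^ 3 ≤ 3 * r ^ 2 * D + 3 * r * D ^ 2 + D ^ 3 := by
        nlinarith [pow_le_pow_left₀ hr h 3, mul_nonneg (sq_nonneg r) hD0,
          mul_nonneg hr (sq_nonneg D)]
      have h2 := mul_le_mul_of_nonneg_left h1 (by positivity : 0 ≤ 4 / 3 * Real.pi)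
      linarith
  · linarith

/-- The lattice points in a ball, counted up to an error governed by the successive minima. -/
theorem abs_ncard_latticeBall_sub_one_sub_le {r : ℝ} (hr : successiveMinimum Λ 1 ≤ r) :
    |((latticeBall Λ r).ncard - 1 : ℝ) - 4 / 3 * Real.pi * r ^ 3 / ZLattice.covolume Λ| ≤
      301 * ((successiveMinimum Λ 2 * successiveMinimum Λ 3 * r +
        successiveMinimum Λ 3 * r ^ 2) / ZLattice.covolume Λ) := by
  obtain ⟨p1, p12, p23⟩ := successiveMinimum_chain Λ
  have hcov := covolume_le_prod_successiveMinimum Λ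
  obtain ⟨b, hb, h1, h2, h3⟩ := exists_basis_norm_le Λ
  have hc := ZLattice.covolume_pos Λ
  set l1 := successiveMinimum Λ 1
  set l2 := successiveMinimum Λ 2
  set l3 := successiveMinimum Λ 3
  set c := ZLattice.covolume Λ
  set A : ℝ := ((latticeBall Λ r).ncard : ℝ) with hAdef
  have p2 : 0 < l2 := p1.trans_le p12
  have p3 : 0 < l3 := p2.trans_le p23
  have hr0 : 0 < r := p1.trans_le hr
  have hpi := Real.pi_pos
  have hpi4 := Real.pi_lt_d2
  have hA : 0 ≤ A := Nat.cast_nonneg _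
  have hfin := finite_latticeBall Λ r
  -- This pays for removing the origin, raising the constant from 300 to 301; it is where r ≥ λ₁
  -- enters.
  have hc1 : c ≤ l2 * l3 * r := by
    calc c ≤ l2 * l3 * l1 := by linarith
      _ ≤ _ := by gcongr
  -- Up to λ₃ the volume is absorbed by the error, so only an upper bound for A is needed.
  have hV : r ≤ l3 → 4 / 3 * Real.pi * r ^ 3 ≤ 300 * (l2 * l3 * r + l3 * r ^ 2) := fun h => by
    have h5 : 0 ≤ l2 * l3 * r := by positivity
    calc _ ≤ 4 / 3 * 3.15 * (l3 * r ^ 2) := by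
          rw [pow_succ' r 2]
          gcongr
      _ ≤ _ := by nlinarith [mul_pos p3 (pow_pos hr0 2)]
  have habs : ∀ X Y : ℝ, 0 ≤ X → X ≤ 300 * Y → 4 / 3 * Real.pi * r ^ 3 ≤ 300 * Y →
      |X - 4 / 3 * Real.pi * r ^ 3| ≤ 300 * Y := fun X Y hX h h' => by
    have : 0 ≤ 4 / 3 * Real.pi * r ^ 3 := by positivity
    exact abs_le.mpr ⟨by linarith, by linarith⟩
  have hkey : |A * c - 4 / 3 * Real.pi * r ^ 3| ≤ 300 * (l2 * l3 * r + l3 * r ^ 2) := by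
    -- The case r = λ₁ is separate because the span lemma needs `b 0` strictly shorter than the next
    -- minimum.
    rcases hr.eq_or_lt with hr1 | hr1
    · have hA1 : A = 1 := by
        rw [hAdef, ncard_latticeBall_successiveMinimum_one hr0 hr1.ge, Nat.cast_one]
      refine habs _ _ (by positivity) ?_ (hV (by linarith))
      rw [hA1]
      have : 0 ≤ l3 * r ^ 2 := by positivity
      linarith
    rcases le_or_gt r l2 with hr2 | hr2
    · have hline : A ≤ 1 + 4 * r / l1 := by
        refine ncard_latticeBall_le_of_line (a := b 0) p1 hr0.le hfin fun v hv => ?_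
        have := mem_span_of_norm_lt_successiveMinimum (Λ := Λ) (k := 1) (w := fun _ => b 0)
          (linearIndependent_unique_iff.mpr (b.ne_zero 0)) (fun _ => hb 0)
          (fun _ => h1.trans_lt (hr1.trans_le hr2)) hv.1 (hv.2.trans_le hr2)
        rw [Set.range_const, Submodule.mem_span_singleton] at this
        obtain ⟨t, ht⟩ := this
        exact ⟨t, ht.symm⟩
      refine habs _ _ (by positivity) ?_ (hV (by linarith))
      have : 0 ≤ l3 * r ^ 2 := by positivity
      calc A * c ≤ (1 + 4 * r / l1) * (l1 * l2 * l3) := by gcongr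
        _ = (l1 + 4 * r) * (l2 * l3) := by field_simp
        _ ≤ (r + 4 * r) * (l2 * l3) := by gcongr
        _ ≤ _ := by nlinarith [mul_pos (mul_pos p2 p3) hr0]
    rcases le_or_gt r l3 with hr3 | hr3
    · have hli : LinearIndependent ℝ ![b 0, b 1] := by
        have := b.linearIndependent.comp ![0, 1] (by decide)
        convert this using 1
        ext i
        fin_cases i <;> rfl
      have hplane : A ≤ (1 + 4 * r / l1) * (1 + 4 * r / l2) := by
        refine ncard_latticeBall_le_of_plane p1 p12 hr0.le (hb 0) h1 hli hfin fun v hv => ?_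
        have := mem_span_of_norm_lt_successiveMinimum (Λ := Λ) hli
          (fun i => by fin_cases i; exacts [hb 0, hb 1])
          (fun i => by
            fin_cases i
            exacts [h1.trans_lt (hr1.trans_le hr3), h2.trans_lt (hr2.trans_le hr3)])
          hv.1 (hv.2.trans_le hr3)
        rw [Matrix.range_cons, Matrix.range_cons, Matrix.range_empty, Set.union_empty,
          Set.singleton_union, Submodule.mem_span_pair] at this
        obtain ⟨s, t, ht⟩ := this
        exact ⟨s, t, ht.symm⟩
      refine habs _ _ (by positivity) ?_ (hV hr3)
      have : 0 ≤ l2 * l3 * r := by positivity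
      calc A * c ≤ (1 + 4 * r / l1) * (1 + 4 * r / l2) * (l1 * l2 * l3) := by gcongr
        _ = (l1 + 4 * r) * (l2 + 4 * r) * l3 := by field_simp
        _ ≤ (r + 4 * r) * (r + 4 * r) * l3 := by gcongr
        _ ≤ _ := by nlinarith [mul_pos p3 (pow_pos hr0 2)]
    · have hcover : ∀ x : EuclideanSpace ℝ (Fin 3), ∃ p ∈ Λ, ‖x - p‖ ≤ 3 * l3 := by
        intro x
        obtain ⟨p, hp, hxp⟩ := exists_mem_norm_sub_le b hb x
        rw [Fin.sum_univ_three] at hxp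
        exact ⟨p, hp, by linarith⟩
      refine (abs_ncard_latticeBall_sub_le_of_covering Λ (by positivity) hr0.le hcover).trans ?_
      have h5 : r * l3 ^ 2 ≤ l3 * r ^ 2 := by nlinarith [mul_pos hr0 p3]
      have h6 : l3 ^ 3 ≤ l3 * r ^ 2 := by nlinarith [mul_pos p3 p3]
      have h7 : 0 ≤ l2 * l3 * r := by positivity
      -- With D = 3λ₃ ≤ 3r the three terms give 9 + 27 + 27 = 63, and 4/3 · 3.15 · 63 < 300.
      calc _ ≤ 4 / 3 * Real.pi * (63 * (l3 * r ^ 2)) := by gcongr; nlinarith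
        _ ≤ 4 / 3 * 3.15 * (63 * (l3 * r ^ 2)) := by gcongr
        _ ≤ _ := by nlinarith [mul_pos p3 (pow_pos hr0 2)]
  have h5 : (A - 1 : ℝ) - 4 / 3 * Real.pi * r ^ 3 / c =
      (A * c - 4 / 3 * Real.pi * r ^ 3 - c) / c := by
    field_simp
    ring
  rw [h5, abs_div, abs_of_pos hc, ← mul_div_assoc]
  gcongr
  refine (abs_sub _ _).trans ?_
  rw [abs_of_pos hc]
  have : 0 ≤ l3 * r ^ 2 := by positivity
  linarith

end Count

/-! ### The Möbius series at 3 -/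

section Moebius

open ArithmeticFunction

theorem hasSum_moebius_div_cube :
    HasSum (fun n : ℕ => (moebius n : ℝ) / (n : ℝ) ^ 3) (riemannZeta 3).re⁻¹ := by
  have h3 : 1 < (3 : ℂ).re := by norm_num
  have hterm : ∀ n : ℕ, LSeries.term (fun n => ((moebius n : ℤ) : ℂ)) 3 n =
      (((moebius n : ℝ) / (n : ℝ) ^ 3 : ℝ) : ℂ) := by
    intro n
    rcases eq_or_ne n 0 with rfl | hn
    · simp
    · rw [LSeries.term_of_ne_zero hn]
      push_cast
      congr 1
      exact_mod_cast Complex.cpow_natCast (n : ℂ) 3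
  have hsum : Summable (fun n : ℕ => (((moebius n : ℝ) / (n : ℝ) ^ 3 : ℝ) : ℂ)) := by
    simp_rw [← hterm]
    exact LSeriesSummable_moebius_iff.mpr h3
  have hsumR := Complex.summable_ofReal.mp hsum
  have hL : LSeries (fun n => ((moebius n : ℤ) : ℂ)) 3 =
      ((∑' n : ℕ, (moebius n : ℝ) / (n : ℝ) ^ 3 : ℝ) : ℂ) := by
    rw [LSeries, Complex.ofReal_tsum]
    exact tsum_congr hterm
  have h1 := LSeries_zeta_mul_Lseries_moebius h3
  rw [LSeries_zeta_eq_riemannZeta h3, hL] at h1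
  -- The Möbius sum is real, so ζ(3), its inverse, equals its own real part.
  have h2 : (riemannZeta 3).re⁻¹ = ∑' n : ℕ, (moebius n : ℝ) / (n : ℝ) ^ 3 := by
    rw [eq_inv_of_mul_eq_one_left h1, ← Complex.ofReal_inv, Complex.ofReal_re, inv_inv]
  rw [h2]
  exact hsumR.hasSum

/-- Bounding the tail terms by 1/d² instead of 1/d³ is wasteful, but decay of order 1/K suffices. -/
theorem abs_sum_moebius_div_cube_sub_le (K : ℕ) :
    |∑ d ∈ Finset.Icc 1 K, (moebius d : ℝ) / (d : ℝ) ^ 3 - (riemannZeta 3).re⁻¹| ≤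
      2 / (K + 1) := by
  have hlim := hasSum_moebius_div_cube.tendsto_sum_nat
  have h0 : ∑ d ∈ Finset.Icc 1 K, (moebius d : ℝ) / (d : ℝ) ^ 3 =
      ∑ d ∈ Finset.range (K + 1), (moebius d : ℝ) / (d : ℝ) ^ 3 := by
    refine Finset.sum_subset (fun d hd => ?_) (fun d hd hd' => ?_)
    · rw [Finset.mem_Icc] at hd
      rw [Finset.mem_range]
      omega
    · rw [Finset.mem_Icc] at hd'
      rw [Finset.mem_range] at hd
      obtain rfl : d = 0 := by omega
      simp
  rw [h0, abs_sub_comm]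
  refine le_of_tendsto ((hlim.sub_const _).abs) (Filter.eventually_atTop.mpr ⟨K + 1, fun n hn => ?_⟩)
  rw [← Finset.sum_range_add_sum_Ico _ hn, add_sub_cancel_left]
  refine (Finset.abs_sum_le_sum_abs _ _).trans (le_trans ?_ (sum_Ioo_inv_sq_le (α := ℝ) K n))
  refine Finset.sum_le_sum fun d hd => ?_
  rw [Finset.mem_Ico] at hd
  have hd1 : (1 : ℝ) ≤ d := by exact_mod_cast (by omega : 1 ≤ d)
  have hmu : |(moebius d : ℝ)| ≤ 1 := by exact_mod_cast abs_moebius_le_one (n := d)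
  rw [abs_div, abs_of_pos (by positivity : (0 : ℝ) < (d : ℝ) ^ 3), div_le_iff₀ (by positivity)]
  calc |(moebius d : ℝ)| ≤ 1 := hmu
    _ ≤ d := hd1
    _ = _ := by field_simp

theorem sum_divisors_moebius (n : ℕ) :
    ∑ d ∈ n.divisors, (moebius d : ℤ) = if n = 1 then 1 else 0 := by
  rw [← coe_zeta_mul_apply, coe_zeta_mul_moebius, one_apply]

end Moebius

/-! ### Content of lattice vectors and Möbius inversion -/

section Content

theorem isPrimitiveVector_iff_content_eq_one {E : Type*} [AddCommGroup E]
    (Λ : Submodule ℤ E) {v : E} (hv : v ∈ Λ) (h0 : v ≠ 0) {c : ℕ}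
    (hc : ∀ d : ℕ, d ∣ c ↔ ∃ w ∈ Λ, v = (d : ℤ) • w) : IsPrimitiveVector Λ v ↔ c = 1 := by
  constructor
  · rintro ⟨-, -, h⟩
    obtain ⟨w, hw, hvw⟩ := (hc c).mp dvd_rfl
    have := h c w hw hvw
    omega
  · rintro rfl
    refine ⟨hv, h0, fun n w hw hvw => ?_⟩
    have hn : n.natAbs ∣ 1 := by
      rw [hc]
      rcases Int.natAbs_eq n with h | h
      · exact ⟨w, hw, by rw [← h]; exact hvw⟩
      · refine ⟨-w, Λ.neg_mem hw, ?_⟩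
        rw [smul_neg, ← neg_smul, ← h]
        exact hvw
    have := Nat.dvd_one.mp hn
    omega

theorem finite_primitiveVectorsLT {E : Type*} [NormedAddCommGroup E] [NormedSpace ℝ E]
    [FiniteDimensional ℝ E] (Λ : Submodule ℤ E) [DiscreteTopology Λ] (R : ℝ) :
    (primitiveVectorsLT Λ R).Finite :=
  (finite_latticeBall Λ R).subset fun _ hv => ⟨hv.1.1, hv.2⟩

/-- The number of nonzero lattice vectors in a ball that are divisible by `d`. -/
theorem card_filter_divisible {E : Type*} [NormedAddCommGroup E] [NormedSpace ℝ E]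
    [FiniteDimensional ℝ E] (Λ : Submodule ℤ E) [DiscreteTopology Λ] {R : ℝ} {d : ℕ} (hd : 0 < d) (S : Finset E)
    (hS : ∀ v, v ∈ S ↔ v ∈ Λ ∧ v ≠ 0 ∧ ‖v‖ < R) [DecidablePred fun v : E =>
      ∃ w ∈ Λ, v = (d : ℤ) • w] (hR : 0 < R) :
    ((S.filter fun v => ∃ w ∈ Λ, v = (d : ℤ) • w).card : ℝ) =
      (latticeBall Λ (R / d)).ncard - 1 := by
  have hd' : (0 : ℝ) < d := by exact_mod_cast hd
  have hdz : (d : ℤ) ≠ 0 := by exact_mod_cast hd.ne'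
  have hinj : Function.Injective fun w : E => (d : ℤ) • w := by
    intro w w' h
    simp only [← Int.cast_smul_eq_zsmul ℝ] at h
    exact smul_right_injective E (Int.cast_ne_zero.mpr hdz) h
  have hset : (((S.filter fun v => ∃ w ∈ Λ, v = (d : ℤ) • w) : Finset E) : Set E) =
      (fun w => (d : ℤ) • w) '' (latticeBall Λ (R / d) \ {0}) := by
    have hnorm : ∀ w : E, ‖(d : ℤ) • w‖ < R ↔ ‖w‖ < R / d := by
      intro w
      rw [← Int.cast_smul_eq_zsmul ℝ, norm_smul, lt_div_iff₀ hd', mul_comm]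
      simp
    ext v
    simp only [Finset.coe_filter, hS, Set.mem_ofPred_eq, Set.mem_image, Set.mem_sdiff,
      Set.mem_singleton_iff, latticeBall]
    constructor
    · rintro ⟨⟨-, h0, hv⟩, w, hw, rfl⟩
      exact ⟨w, ⟨⟨hw, (hnorm w).mp hv⟩, fun h => h0 (by rw [h, smul_zero])⟩, rfl⟩
    · rintro ⟨w, ⟨⟨hw, hwr⟩, h0⟩, rfl⟩
      exact ⟨⟨Λ.smul_mem _ hw, fun h => h0 (hinj (by simpa using h)), (hnorm w).mpr hwr⟩, w, hw, rfl⟩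
  have h0mem : (0 : E) ∈ latticeBall Λ (R / d) := ⟨Λ.zero_mem, by rw [norm_zero]; positivity⟩
  rw [← Set.ncard_coe_finset, hset, Set.ncard_image_of_injective _ hinj,
    ← Set.ncard_sdiff_singleton_add_one h0mem (finite_latticeBall Λ _)]
  push_cast
  ring

variable {E : Type*} [NormedAddCommGroup E] [NormedSpace ℝ E] [FiniteDimensional ℝ E]
  (Λ : Submodule ℤ E) [DiscreteTopology Λ] [IsZLattice ℝ Λ]

/-- The content of a nonzero lattice vector: the largest natural number dividing it. -/
theorem exists_content {v : E} (hv : v ∈ Λ) (h0 : v ≠ 0) :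
    ∃ c : ℕ, c ≠ 0 ∧ ∀ d : ℕ, d ∣ c ↔ ∃ w ∈ Λ, v = (d : ℤ) • w := by
  have : Module.Finite ℤ Λ := ZLattice.module_finite ℝ Λ
  have : Module.Free ℤ Λ := ZLattice.module_free ℝ Λ
  let b := finBasis ℤ Λ
  set x : Λ := ⟨v, hv⟩ with hx
  have hx0 : x ≠ 0 := fun h => h0 (congrArg Subtype.val h)
  -- The content is the gcd of the coordinates in a ℤ-basis of Λ.
  refine ⟨(Finset.univ.gcd fun i => b.repr x i).natAbs, ?_, fun d => ?_⟩
  · rw [Int.natAbs_ne_zero, Ne, Finset.gcd_eq_zero_iff]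
    intro h
    exact hx0 (b.ext_elem fun i => by simpa using h i (Finset.mem_univ i))
  · rw [← Int.natCast_dvd, Finset.dvd_gcd_iff]
    constructor
    · intro h
      choose t ht using fun i => h i (Finset.mem_univ i)
      refine ⟨(∑ i, t i • b i : Λ), Subtype.coe_prop _, ?_⟩
      rw [← Submodule.coe_smul_of_tower, Finset.smul_sum]
      simp_rw [smul_smul, ← ht, b.sum_repr, hx]
    · rintro ⟨w, hw, hvw⟩ i _
      have : x = (d : ℤ) • (⟨w, hw⟩ : Λ) := Subtype.ext hvw
      rw [this, map_smul]
      exact Dvd.intro _ rfl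

/-- Möbius inversion for primitive lattice vectors. -/
theorem ncard_primitiveVectorsLT_eq_sum {R : ℝ} (hR : 0 < R) {K : ℕ}
    (hl : 0 < successiveMinimum Λ 1) (hK : K = ⌊R / successiveMinimum Λ 1⌋₊) :
    ((primitiveVectorsLT Λ R).ncard : ℝ) = ∑ d ∈ Finset.Icc 1 K,
      (ArithmeticFunction.moebius d : ℝ) * ((latticeBall Λ (R / d)).ncard - 1) := by
  classical
  let S : Finset E := (finite_latticeBall Λ R).toFinset.erase 0
  have hS : ∀ v, v ∈ S ↔ v ∈ Λ ∧ v ≠ 0 ∧ ‖v‖ < R := fun v => by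
    simp only [S, Finset.mem_erase, Set.Finite.mem_toFinset, latticeBall, Set.mem_ofPred_eq]
    tauto
  have hprim : primitiveVectorsLT Λ R = (S.filter fun v => IsPrimitiveVector Λ v : Finset E) := by
    ext v
    simp only [primitiveVectorsLT, Set.mem_ofPred_eq, Finset.coe_filter, hS]
    exact ⟨fun h => ⟨⟨h.1.1, h.1.2.1, h.2⟩, h.1⟩, fun h => ⟨h.2, h.1.2.2⟩⟩
  -- Primitivity is ∑ μ(d) over the divisors d of the content. All of them are at most K, a range
  -- independent of v, so the sums can be exchanged.
  have hpoint : ∀ v ∈ S, (if IsPrimitiveVector Λ v then (1 : ℝ) else 0) =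
      ∑ d ∈ Finset.Icc 1 K, if ∃ w ∈ Λ, v = (d : ℤ) • w then
        (ArithmeticFunction.moebius d : ℝ) else 0 := by
    intro v hv
    obtain ⟨hvΛ, hv0, hvR⟩ := (hS v).mp hv
    obtain ⟨c, hc0, hc⟩ := exists_content Λ hvΛ hv0
    have hcK : c ≤ K := by
      obtain ⟨w, hw, hvw⟩ := (hc c).mp dvd_rfl
      have hw0 : w ≠ 0 := fun h => hv0 (by rw [hvw, h, smul_zero])
      have hw1 := successiveMinimum_one_le hw hw0
      have hnv : ‖v‖ = c * ‖w‖ := by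
        rw [hvw, ← Int.cast_smul_eq_zsmul ℝ, norm_smul]
        simp
      rw [hK, Nat.le_floor_iff (by positivity), le_div_iff₀ hl]
      calc (c : ℝ) * successiveMinimum Λ 1 ≤ c * ‖w‖ := by gcongr
        _ ≤ R := by rw [← hnv]; exact hvR.le
    have hdiv : c.divisors =
        (Finset.Icc 1 K).filter fun d : ℕ => ∃ w ∈ Λ, v = (d : ℤ) • w := by
      ext d
      rw [Nat.mem_divisors, Finset.mem_filter, Finset.mem_Icc, hc]
      constructor
      · rintro ⟨h, -⟩
        have h' := (hc d).mpr h
        exact ⟨⟨Nat.pos_of_dvd_of_pos h' (Nat.pos_of_ne_zero hc0),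
          (Nat.le_of_dvd (Nat.pos_of_ne_zero hc0) h').trans hcK⟩, h⟩
      · exact fun h => ⟨h.2, hc0⟩
    rw [← Finset.sum_filter, ← hdiv]
    simp only [isPrimitiveVector_iff_content_eq_one Λ hvΛ hv0 hc]
    have := sum_divisors_moebius c
    have h2 : ((∑ d ∈ c.divisors, (ArithmeticFunction.moebius d : ℤ) : ℤ) : ℝ) =
        ((if c = 1 then 1 else 0 : ℤ) : ℝ) := by rw [this]
    push_cast at h2
    exact h2.symm
  rw [hprim, Set.ncard_coe_finset, Finset.card_filter, Nat.cast_sum]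
  push_cast
  rw [Finset.sum_congr rfl hpoint, Finset.sum_comm]
  refine Finset.sum_congr rfl fun d hd => ?_
  rw [← card_filter_divisible Λ (Finset.mem_Icc.mp hd).1 S hS hR, ← Finset.sum_filter,
    Finset.sum_const, nsmul_eq_mul, mul_comm]

end Content

/-! ### Summing the errors -/

theorem sum_Icc_inv_le_logStar {K : ℕ} {x : ℝ} (hK : (K : ℝ) ≤ x) :
    ∑ d ∈ Finset.Icc 1 K, (d : ℝ)⁻¹ ≤ 2 * logStar x := by
  have h1 : (1 : ℝ) ≤ logStar x := le_max_left _ _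
  rcases Nat.eq_zero_or_pos K with rfl | hpos
  · simpa using (by linarith : (0 : ℝ) ≤ 2 * logStar x)
  · have h2 := harmonic_le_one_add_log K
    rw [harmonic_eq_sum_Icc] at h2
    push_cast at h2
    have h3 : Real.log K ≤ logStar x :=
      (Real.log_le_log (by exact_mod_cast hpos) hK).trans (le_max_right _ _)
    linarith

theorem sum_Icc_inv_sq_le_two (K : ℕ) : ∑ d ∈ Finset.Icc 1 K, ((d : ℝ) ^ 2)⁻¹ ≤ 2 := by
  have h := sum_Ioo_inv_sq_le (α := ℝ) 0 (K + 1)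
  have h2 : Finset.Ioo 0 (K + 1) = Finset.Icc 1 K := by
    ext d
    simp only [Finset.mem_Ioo, Finset.mem_Icc]
    omega
  rw [h2] at h
  simpa using h

theorem mainTheorem5 :
    ∃ C : ℝ, 0 < C ∧
      ∀ (Λ : Submodule ℤ (EuclideanSpace ℝ (Fin 3))) [DiscreteTopology Λ] [IsZLattice ℝ Λ]
        (R : ℝ), 0 < R →
        (primitiveVectorsLT Λ R).Finite ∧
        |((primitiveVectorsLT Λ R).ncard : ℝ) -
            4 * Real.pi / (3 * (riemannZeta 3).re) * (R ^ 3 / ZLattice.covolume Λ)| ≤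
          C * (logStar (R / successiveMinimum Λ 1) *
                (successiveMinimum Λ 2 * successiveMinimum Λ 3 * R / ZLattice.covolume Λ) +
              successiveMinimum Λ 3 * R ^ 2 / ZLattice.covolume Λ) := by
  -- The argument needs only 602 + 9 = 611.
  refine ⟨1000, by norm_num, fun Λ _ _ R hR => ⟨finite_primitiveVectorsLT Λ R, ?_⟩⟩
  obtain ⟨p1, p12, p23⟩ := successiveMinimum_chain Λ
  have hc := ZLattice.covolume_pos Λ
  set K := ⌊R / successiveMinimum Λ 1⌋₊ with hK
  rw [ncard_primitiveVectorsLT_eq_sum Λ hR p1 hK]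
  have hcount : ∀ d ∈ Finset.Icc 1 K, _ := fun d hd =>
    abs_ncard_latticeBall_sub_one_sub_le Λ (r := R / d) (by
      rw [Finset.mem_Icc] at hd
      have hd0 : (0 : ℝ) < d := by exact_mod_cast hd.1
      have hdK : (d : ℝ) ≤ R / successiveMinimum Λ 1 :=
        (Nat.le_floor_iff (by positivity)).mp hd.2
      rw [le_div_iff₀ p1] at hdK
      rwa [le_div_iff₀ hd0, mul_comm])
  have hKle : (K : ℝ) ≤ R / successiveMinimum Λ 1 := Nat.floor_le (by positivity)
  have hKlt : R / successiveMinimum Λ 1 < K + 1 := Nat.lt_floor_add_one _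
  have hharm := sum_Icc_inv_le_logStar hKle
  have hsq := sum_Icc_inv_sq_le_two K
  have htail := abs_sum_moebius_div_cube_sub_le K
  set l1 := successiveMinimum Λ 1
  set l2 := successiveMinimum Λ 2
  set l3 := successiveMinimum Λ 3
  set c := ZLattice.covolume Λ
  set M := (riemannZeta 3).re⁻¹ with hM
  set a : ℕ → ℝ := fun d => ((latticeBall Λ (R / d)).ncard - 1 : ℝ)
  have p2 : 0 < l2 := p1.trans_le p12
  have p3 : 0 < l3 := p2.trans_le p23
  have hpi := Real.pi_pos
  have hpi4 := Real.pi_lt_d2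
  set V : ℝ := 4 / 3 * Real.pi with hV
  have hV0 : 0 < V := by positivity
  have hmain : 4 * Real.pi / (3 * (riemannZeta 3).re) * (R ^ 3 / c) = V * R ^ 3 / c * M := by
    rw [hM, hV, div_mul_eq_div_div, div_eq_mul_inv _ (riemannZeta 3).re]
    ring
  -- The first sum collects the counting errors; the second term is the truncation of 1/ζ(3).
  have hsplit : ∑ d ∈ Finset.Icc 1 K, (ArithmeticFunction.moebius d : ℝ) * a d -
      V * R ^ 3 / c * M =
      ∑ d ∈ Finset.Icc 1 K, (ArithmeticFunction.moebius d : ℝ) *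
        (a d - V * (R / d) ^ 3 / c) +
      V * R ^ 3 / c *
        (∑ d ∈ Finset.Icc 1 K, (ArithmeticFunction.moebius d : ℝ) / (d : ℝ) ^ 3 - M) := by
    have h : ∑ d ∈ Finset.Icc 1 K, (ArithmeticFunction.moebius d : ℝ) *
        (a d - V * (R / d) ^ 3 / c) =
        ∑ d ∈ Finset.Icc 1 K, (ArithmeticFunction.moebius d : ℝ) * a d - V * R ^ 3 / c *
          ∑ d ∈ Finset.Icc 1 K, (ArithmeticFunction.moebius d : ℝ) / (d : ℝ) ^ 3 := by
      rw [Finset.mul_sum, ← Finset.sum_sub_distrib]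
      refine Finset.sum_congr rfl fun d _ => ?_
      rw [div_pow]
      ring
    rw [h]
    ring
  have hfirst : |∑ d ∈ Finset.Icc 1 K, (ArithmeticFunction.moebius d : ℝ) *
      (a d - V * (R / d) ^ 3 / c)| ≤
      602 * (logStar (R / l1) * (l2 * l3 * R / c) + l3 * R ^ 2 / c) := by
    calc _ ≤ ∑ d ∈ Finset.Icc 1 K,
          301 * ((l2 * l3 * R / c) * (d : ℝ)⁻¹ + (l3 * R ^ 2 / c) * ((d : ℝ) ^ 2)⁻¹) := by
          refine (Finset.abs_sum_le_sum_abs _ _).trans (Finset.sum_le_sum fun d hd => ?_)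
          have hmu : |(ArithmeticFunction.moebius d : ℝ)| ≤ 1 := by
            exact_mod_cast ArithmeticFunction.abs_moebius_le_one (n := d)
          rw [abs_mul]
          refine (mul_le_of_le_one_left (abs_nonneg _) hmu).trans ((hcount d hd).trans_eq ?_)
          rw [div_pow]
          ring
      _ = 301 * ((l2 * l3 * R / c) * ∑ d ∈ Finset.Icc 1 K, (d : ℝ)⁻¹ +
          (l3 * R ^ 2 / c) * ∑ d ∈ Finset.Icc 1 K, ((d : ℝ) ^ 2)⁻¹) := by
          rw [← Finset.mul_sum, Finset.sum_add_distrib, Finset.mul_sum, Finset.mul_sum]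
      _ ≤ 301 * ((l2 * l3 * R / c) * (2 * logStar (R / l1)) + (l3 * R ^ 2 / c) * 2) := by
          gcongr
      _ = _ := by ring
  -- K + 1 > R/λ₁ turns the tail 2/(K + 1) into 2λ₁/R, and 2V = 8π/3 < 9. If R < λ₁, so that K = 0,
  -- this term is the whole error.
  have hsecond : |V * R ^ 3 / c *
      (∑ d ∈ Finset.Icc 1 K, (ArithmeticFunction.moebius d : ℝ) / (d : ℝ) ^ 3 - M)| ≤
      9 * (l3 * R ^ 2 / c) := by
    rw [abs_mul, abs_of_pos (by positivity)]
    calc _ ≤ V * R ^ 3 / c * (2 / (K + 1)) := by gcongr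
      _ ≤ V * R ^ 3 / c * (2 / (R / l1)) := by gcongr
      _ = 2 * V * (l1 * R ^ 2 / c) := by field_simp
      _ ≤ 9 * (l3 * R ^ 2 / c) := by
          gcongr
          · rw [hV]
            linarith
          · exact p12.trans p23
  rw [hmain, hsplit]
  refine (abs_add_le _ _).trans ((add_le_add hfirst hsecond).trans ?_)
  have h1 : (1 : ℝ) ≤ logStar (R / l1) := le_max_left _ _
  have h2 : 0 ≤ logStar (R / l1) * (l2 * l3 * R / c) := by positivity
  have h3 : 0 ≤ l3 * R ^ 2 / c := by positivity
  linarith
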